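/- Let $p$ be a prime and let $k$ be a field of characteristic $p$. For $\ell\in\mathbb N=\{0,1,2,\dots\}$ let $k(x,z_1,\dots,z_\ell)$ be the field of rational functions in $\ell+1$ independent variables, with the $k$-linear derivation $\partial$ (also written $'$) given by $x'=1$ and $z_i'=\dfrac{1}{x\,z_1\cdots z_{i-1}}$ for $1\le i\le \ell$ (so $z_1'=1/x$). Let $L=\sum_{i=0}^n a_i\partial^i\in k[x][\partial]$ be a linear differential operator of order $n$; it acts on $k(x,z_1,\dots,z_\ell)$ by $Ly=\sum_i a_i\,\partial^i y$. Suppose that $L$ has nilpotent $p$-curvature, i.e. that left multiplication by $\partial^p$ on the left module $k(x)[\partial]/k(x)[\partial]L$ is nilpotent, where $k(x)[\partial]$ is the ring of differential operators over $k(x)$, with $\partial a=a\partial+a'$. Then there is $\ell\in\mathbb N$ such that $Ly=0$ has a full basis of polynomial solutions in $k(x,z_1,\dots,z_\ell)$: there are $n$ elements $y_1,\dots,y_n\in k[x,z_1,\dots,z_\ell]$ that form a basis of the solution space $\{y\in k(x,z_1,\dots,z_\ell): Ly=0\}$ over the field of constants $\{c\in k(x,z_1,\dots,z_\ell): c'=0\}$.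 -/

import Mathlib

open scoped Polynomial Differential

namespace PCurv

/-! ### The ring `R[∂]` of linear differential operators over a differential ring `R` -/

section DiffOp

variable {R : Type*} [CommRing R]

/-- Left multiplication by a coefficient `a` on operators `∑ aᵢ ∂ⁱ`, written as polynomials
`∑ aᵢ Xⁱ` with the coefficients on the left. -/
noncomputable def leftC (a : R) : Module.End ℤ R[X] := LinearMap.mulLeft ℤ (Polynomial.C a)

theorem leftC_apply (a : R) (f : R[X]) : leftC a f = Polynomial.C a * f := rfl

theorem leftC_add (a b : R) : leftC (a + b) = leftC a + leftC b := by
  refine LinearMap.ext fun f => ?_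
  simp only [leftC_apply, LinearMap.add_apply, map_add, add_mul]

theorem leftC_mul (a b : R) : leftC (a * b) = leftC a * leftC b := by
  refine LinearMap.ext fun f => ?_
  simp only [leftC_apply, Module.End.mul_apply, map_mul, mul_assoc]

theorem leftC_zero : leftC (0 : R) = 0 := by
  refine LinearMap.ext fun f => ?_
  simp only [leftC_apply, map_zero, zero_mul, LinearMap.zero_apply]

theorem leftC_one : leftC (1 : R) = 1 := by
  refine LinearMap.ext fun f => ?_
  simp only [leftC_apply, map_one, one_mul, Module.End.one_apply]

variable [Differential R]

/-- Left multiplication by `∂` on operators: `∂ ∘ ∑ aᵢ ∂ⁱ = ∑ aᵢ′ ∂ⁱ + ∑ aᵢ ∂ⁱ⁺¹`. -/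
noncomputable def leftD : Module.End ℤ R[X] :=
  (Differential.mapCoeffs : Derivation ℤ R[X] R[X]).toLinearMap +
    LinearMap.mulLeft ℤ Polynomial.X

theorem leftD_apply (f : R[X]) :
    leftD f = Differential.mapCoeffs f + Polynomial.X * f := rfl

/-- Left multiplication by the operator `∑ aᵢ ∂ⁱ`. -/
noncomputable def leftMul (P : R[X]) : Module.End ℤ R[X] := P.sum fun i a => leftC a * leftD ^ i

theorem leftMul_zero : leftMul (0 : R[X]) = 0 := by
  simp [leftMul]

theorem leftMul_add (P Q : R[X]) : leftMul (P + Q) = leftMul P + leftMul Q :=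
  Polynomial.sum_add_index _ _ _ (fun i => by rw [leftC_zero, zero_mul])
    (fun i a b => by rw [leftC_add, add_mul])

theorem leftMul_monomial (n : ℕ) (a : R) :
    leftMul (Polynomial.monomial n a) = leftC a * leftD ^ n :=
  Polynomial.sum_monomial_index _ _ (by rw [leftC_zero, zero_mul])

theorem leftD_monomial (n : ℕ) (a : R) :
    leftD (Polynomial.monomial n a) =
      Polynomial.monomial n (a′) + Polynomial.monomial (n + 1) a := by
  rw [leftD_apply, Differential.mapCoeffs_monomial, Polynomial.X_mul_monomial]

theorem leftD_mul_leftC (a : R) : leftD * leftC a = leftC (a′) + leftC a * leftD := by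
  refine LinearMap.ext fun f => ?_
  simp only [leftC_apply, leftD_apply, Module.End.mul_apply, LinearMap.add_apply,
    Derivation.leibniz, Differential.mapCoeffs_C, smul_eq_mul]
  ring

theorem leftMul_leftC (a : R) (Q : R[X]) : leftMul (leftC a Q) = leftC a * leftMul Q := by
  induction Q using Polynomial.induction_on' with
  | add p q hp hq => rw [map_add, leftMul_add, leftMul_add, hp, hq, mul_add]
  | monomial n b =>
    rw [leftC_apply, Polynomial.C_mul_monomial, leftMul_monomial, leftMul_monomial, leftC_mul,
      mul_assoc]

theorem leftMul_leftD (Q : R[X]) : leftMul (leftD Q) = leftD * leftMul Q := by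
  induction Q using Polynomial.induction_on' with
  | add p q hp hq => rw [map_add, leftMul_add, leftMul_add, hp, hq, mul_add]
  | monomial n b =>
    rw [leftD_monomial, leftMul_add, leftMul_monomial, leftMul_monomial, leftMul_monomial,
      ← mul_assoc, leftD_mul_leftC, add_mul, pow_succ', mul_assoc]

theorem leftMul_leftD_pow (n : ℕ) (Q : R[X]) :
    leftMul ((leftD ^ n) Q) = leftD ^ n * leftMul Q := by
  induction n with
  | zero => simp
  | succ n ih =>
    rw [pow_succ', Module.End.mul_apply, leftMul_leftD, ih, mul_assoc]

theorem leftMul_leftMul (P Q : R[X]) : leftMul (leftMul P Q) = leftMul P * leftMul Q := by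
  induction P using Polynomial.induction_on' with
  | add p q hp hq =>
    rw [leftMul_add, LinearMap.add_apply, leftMul_add, hp, hq, add_mul]
  | monomial n a =>
    rw [leftMul_monomial, Module.End.mul_apply, leftMul_leftC, leftMul_leftD_pow, mul_assoc]

theorem leftMul_one : leftMul (1 : R[X]) = 1 := by
  rw [← Polynomial.monomial_zero_one, leftMul_monomial, leftC_one, pow_zero, one_mul]

theorem leftD_pow_one (n : ℕ) : (leftD ^ n) (1 : R[X]) = Polynomial.monomial n 1 := by
  induction n with
  | zero => simp
  | succ n ih => rw [pow_succ', Module.End.mul_apply, ih, leftD_monomial]; simp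

theorem leftMul_apply_one (P : R[X]) : leftMul P 1 = P := by
  induction P using Polynomial.induction_on' with
  | add p q hp hq => rw [leftMul_add, LinearMap.add_apply, hp, hq]
  | monomial n a =>
    rw [leftMul_monomial, Module.End.mul_apply, leftD_pow_one, leftC_apply,
      Polynomial.C_mul_monomial, mul_one]

end DiffOp

/-- The ring `R[∂]` of linear differential operators over a differential ring `R`: the operator
`∑ aᵢ ∂ⁱ` is stored as the polynomial `∑ aᵢ Xⁱ`. Its multiplication is not that of polynomials,
but composition of operators, determined by `∂ a = a ∂ + a′`. -/
def DiffOp (R : Type*) [CommRing R] : Type _ := R[X]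

namespace DiffOp

section Ring

variable {R : Type*} [CommRing R]

/-- The operator `∑ aᵢ ∂ⁱ` with the coefficients of the polynomial `∑ aᵢ Xⁱ`. -/
def ofPoly (P : R[X]) : DiffOp R := P

/-- The polynomial `∑ aᵢ Xⁱ` of coefficients of the operator `∑ aᵢ ∂ⁱ`. -/
def toPoly (L : DiffOp R) : R[X] := L

variable [Differential R]

noncomputable instance : Ring (DiffOp R) where
  __ := (inferInstanceAs (AddCommGroup R[X]) : AddCommGroup (DiffOp R))
  mul P Q := ofPoly (leftMul P.toPoly Q.toPoly)
  one := ofPoly 1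
  left_distrib P Q S := map_add (leftMul P.toPoly) Q.toPoly S.toPoly
  right_distrib P Q S :=
    congrArg (fun f : Module.End ℤ R[X] => f S.toPoly) (leftMul_add P.toPoly Q.toPoly)
  zero_mul P := congrArg (fun f : Module.End ℤ R[X] => f P.toPoly) leftMul_zero
  mul_zero P := map_zero (leftMul P.toPoly)
  mul_assoc P Q S :=
    congrArg (fun f : Module.End ℤ R[X] => f S.toPoly) (leftMul_leftMul P.toPoly Q.toPoly)
  one_mul P := congrArg (fun f : Module.End ℤ R[X] => f P.toPoly) leftMul_one
  mul_one P := leftMul_apply_one P.toPoly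

/-- The operator `∂`. -/
noncomputable def D : DiffOp R := ofPoly Polynomial.X

/-- An element `a` of `R` as an operator of order zero. -/
noncomputable def coeffOp (a : R) : DiffOp R := ofPoly (Polynomial.C a)

theorem mul_def (P Q : DiffOp R) : (P * Q).toPoly = leftMul P.toPoly Q.toPoly := rfl

theorem coeffOp_mul_eq (a : R) (Q : DiffOp R) :
    (coeffOp a * Q).toPoly = Polynomial.C a * Q.toPoly := by
  rw [mul_def]
  change leftMul (Polynomial.C a) _ = _
  rw [← Polynomial.monomial_zero_left, leftMul_monomial, pow_zero, mul_one, leftC_apply,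
    Polynomial.monomial_zero_left]

theorem D_mul_eq (Q : DiffOp R) :
    (D * Q).toPoly = Differential.mapCoeffs Q.toPoly + Polynomial.X * Q.toPoly := by
  rw [mul_def]
  change leftMul Polynomial.X _ = _
  rw [← Polynomial.monomial_one_one_eq_X, leftMul_monomial, leftC_one, one_mul, pow_one,
    leftD_apply, Polynomial.monomial_one_one_eq_X]

/-- The commutation rule `∂ a = a ∂ + a′`. -/
theorem D_mul_coeffOp (a : R) : D * coeffOp a = coeffOp a * D + coeffOp (a′) := by
  change (D * coeffOp a).toPoly = (coeffOp a * D).toPoly + (coeffOp (a′)).toPoly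
  rw [D_mul_eq, coeffOp_mul_eq]
  simp [coeffOp, D, ofPoly, toPoly]
  ring

theorem D_pow_eq (n : ℕ) : (D ^ n : DiffOp R).toPoly = Polynomial.X ^ n := by
  induction n with
  | zero => rfl
  | succ n ih =>
    rw [pow_succ', D_mul_eq, ih, pow_succ', ← Polynomial.monomial_one_right_eq_X_pow,
      Differential.mapCoeffs_monomial]
    simp

/-- The left module `R[∂] / R[∂]L`. -/
abbrev Quot (L : DiffOp R) : Type _ := DiffOp R ⧸ Submodule.span (DiffOp R) {L}

/-- The `p`-curvature of `L`: the action of left multiplication by `∂ᵖ` on `R[∂] / R[∂]L`. -/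
noncomputable def pCurvature (p : ℕ) (L : DiffOp R) : Module.End ℤ L.Quot where
  toFun u := (D ^ p : DiffOp R) • u
  map_add' u v := smul_add _ u v
  map_smul' n u := smul_comm _ n u

end Ring

/-- The order of an operator: the largest `n` such that `∂ⁿ` has a nonzero coefficient. -/
noncomputable def order {R : Type*} [CommRing R] (L : DiffOp R) : ℕ := L.toPoly.natDegree

/-- The operator obtained by applying a ring homomorphism to the coefficients. -/
noncomputable def map {R S : Type*} [CommRing R] [CommRing S] (φ : R →+* S) (L : DiffOp R) :
    DiffOp S :=
  ofPoly (L.toPoly.map φ)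

end DiffOp

/-! ### Constants and solutions in a differential field -/

section Solutions

variable (F : Type*) [Field F] [Differential F]

/-- The field of constants of a differential field. -/
def constants : Subfield F where
  carrier := {c | c′ = 0}
  mul_mem' {a b} ha hb := by
    simp only [Set.mem_ofPred_eq] at ha hb ⊢; simp [ha, hb]
  one_mem' := by simp
  add_mem' {a b} ha hb := by
    simp only [Set.mem_ofPred_eq] at ha hb ⊢; simp [ha, hb]
  zero_mem' := by simp
  neg_mem' {a} ha := by
    simp only [Set.mem_ofPred_eq] at ha ⊢; simp [ha]
  inv_mem' a ha := by
    simp only [Set.mem_ofPred_eq] at ha ⊢; simp [Derivation.leibniz_inv, ha]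

/-- The derivation of a differential field, as a linear map over the constants. -/
def derivLin : F →ₗ[constants F] F where
  toFun f := Differential.deriv f
  map_add' := map_add _
  map_smul' c f := by
    have hc : (c : F)′ = 0 := c.2
    simp [Subfield.smul_def, hc]

variable {F}

/-- The map `y ↦ ∑ φ(aᵢ) y⁽ⁱ⁾`, where `L = ∑ aᵢ ∂ⁱ` and `φ` carries the coefficients of `L` to
the field in which `y` varies. -/
noncomputable def DiffOp.act {R : Type*} [CommRing R] (φ : R →+* F) (L : DiffOp R) :
    F →ₗ[constants F] F :=
  L.toPoly.sum fun i a => LinearMap.mulLeft (constants F) (φ a) * derivLin F ^ i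

/-- The space of solutions of `L y = 0`, over the field of constants. -/
noncomputable def DiffOp.solutions {R : Type*} [CommRing R] (φ : R →+* F) (L : DiffOp R) :
    Submodule (constants F) F :=
  LinearMap.ker (L.act φ)

theorem DiffOp.act_apply {R : Type*} [CommRing R] (φ : R →+* F) (L : DiffOp R) (y : F) :
    L.act φ y = L.toPoly.sum fun i a => φ a * (Differential.deriv : F → F)^[i] y := by
  have h : ∀ i : ℕ, (derivLin F ^ i) y = (Differential.deriv : F → F)^[i] y := fun i => by
    rw [Module.End.pow_apply]; rfl
  simp [DiffOp.act, Polynomial.sum_def, LinearMap.sum_apply, h]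

end Solutions

/-! ### Extending a derivation to the field of fractions -/

section FracDeriv

variable {A K : Type*} [CommRing A] [Field K] [Algebra A K] [IsFractionRing A K]

/-- For a derivation `d : A → K`, the homomorphism `a ↦ a + d(a) ε` into the dual numbers of `K`. -/
def fracDerivAux (d : Derivation ℤ A K) : A →+* TrivSqZeroExt K K where
  toFun a := TrivSqZeroExt.inl (algebraMap A K a) + TrivSqZeroExt.inr (d a)
  map_one' := by ext <;> simp
  map_mul' a b := by
    ext
    · simp
    · simp only [TrivSqZeroExt.snd_add, TrivSqZeroExt.snd_mul, TrivSqZeroExt.fst_add,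
        TrivSqZeroExt.fst_inl, TrivSqZeroExt.fst_inr, TrivSqZeroExt.snd_inl, TrivSqZeroExt.snd_inr,
        Derivation.leibniz, Algebra.smul_def, MulOpposite.smul_eq_mul_unop, MulOpposite.unop_op,
        Algebra.algebraMap_self, RingHom.id_apply, add_zero, zero_add]
      ring
  map_zero' := by ext <;> simp
  map_add' a b := by ext <;> simp

theorem isUnit_fracDerivAux (d : Derivation ℤ A K) (a : nonZeroDivisors A) :
    IsUnit (fracDerivAux d a) := by
  rw [TrivSqZeroExt.isUnit_iff_isUnit_fst]
  simpa [fracDerivAux] using IsLocalization.map_units K a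

/-- The extension of `a ↦ a + d(a) ε` to the field of fractions. -/
noncomputable def fracDerivHom (d : Derivation ℤ A K) : K →+* TrivSqZeroExt K K :=
  IsLocalization.lift (M := nonZeroDivisors A) (isUnit_fracDerivAux d)

theorem fracDerivHom_algebraMap (d : Derivation ℤ A K) (a : A) :
    fracDerivHom d (algebraMap A K a) = fracDerivAux d a :=
  IsLocalization.lift_eq _ _

theorem fst_fracDerivHom (d : Derivation ℤ A K) (f : K) : (fracDerivHom d f).fst = f := by
  have h : ((TrivSqZeroExt.fstHom ℤ K K).toRingHom.comp (fracDerivHom d)) = RingHom.id K := by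
    apply IsLocalization.ringHom_ext (nonZeroDivisors A)
    ext a
    simp [fracDerivHom_algebraMap, fracDerivAux]
  exact congrArg (fun g : K →+* K => g f) h

/-- The unique derivation of the field of fractions `K` of `A` that extends `d : A → K`. -/
noncomputable def fracDeriv (d : Derivation ℤ A K) : Derivation ℤ K K :=
  Derivation.mk' ((TrivSqZeroExt.sndHom K K).toAddMonoidHom.comp
      (fracDerivHom d).toAddMonoidHom).toIntLinearMap fun f g => by
    simp [fst_fracDerivHom, mul_comm]

theorem fracDeriv_algebraMap (d : Derivation ℤ A K) (a : A) :
    fracDeriv d (algebraMap A K a) = d a := by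
  change (fracDerivHom d (algebraMap A K a)).snd = d a
  simp [fracDerivHom_algebraMap, fracDerivAux]

end FracDeriv

/-! ### The differential rings `k[x]`, `k(x)` and `k(x, z₁, …, z_ℓ)` -/

section Fields

variable (k : Type*) [Field k]

/-- `k[x]` with `x′ = 1`. -/
noncomputable instance : Differential k[X] :=
  ⟨(Polynomial.derivative' (R := k)).restrictScalars ℤ⟩

/-- `k(x)` with `x′ = 1`. -/
noncomputable instance : Differential (RatFunc k) :=
  ⟨fracDeriv ((Polynomial.mkDerivation k (1 : RatFunc k)).restrictScalars ℤ)⟩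

variable (ℓ : ℕ)

/-- The field `k(x, z₁, …, z_ℓ)` of rational functions in `ℓ + 1` independent variables. The
variable of index `0` is `x`, the variable of index `i ≥ 1` is `zᵢ`. -/
abbrev LogField : Type _ := FractionRing (MvPolynomial (Fin (ℓ + 1)) k)

/-- The variables `x` (for `i = 0`) and `zᵢ` (for `i ≥ 1`) of `k(x, z₁, …, z_ℓ)`. -/
noncomputable def LogField.var (i : Fin (ℓ + 1)) : LogField k ℓ :=
  algebraMap (MvPolynomial (Fin (ℓ + 1)) k) (LogField k ℓ) (MvPolynomial.X i)

/-- `k(x, z₁, …, z_ℓ)` with the `k`-linear derivation with `x′ = 1` and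
`zᵢ′ = 1 / (x z₁ ⋯ zᵢ₋₁)`; both rules say that the derivative of a variable is the inverse of the
product of the variables before it. -/
noncomputable instance : Differential (LogField k ℓ) :=
  ⟨fracDeriv ((MvPolynomial.mkDerivation k fun i : Fin (ℓ + 1) =>
    (∏ j ∈ Finset.Iio i, LogField.var k ℓ j)⁻¹).restrictScalars ℤ)⟩

theorem LogField.deriv_var (i : Fin (ℓ + 1)) :
    (LogField.var k ℓ i)′ = (∏ j ∈ Finset.Iio i, LogField.var k ℓ j)⁻¹ := by
  exact (fracDeriv_algebraMap _ _).trans (MvPolynomial.mkDerivation_X k _ i)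

/-- The inclusion of `k[x]` in `k(x, z₁, …, z_ℓ)`. -/
noncomputable def LogField.ofPoly : k[X] →+* LogField k ℓ :=
  (Polynomial.aeval (LogField.var k ℓ 0)).toRingHom

end Fields

end PCurv

namespace PCurv

/-! ### Iterates of a derivation -/

section Iterate

/-! Applying a vanishing power of the `p`-curvature to the class of `1` gives `Q * L = ∂ᴺ` over
`k(x)`, for every large `N` (`DiffOp.exists_mul_eq_D_pow`). It then suffices to find a field in
which `∂ᴺ` has `N` independent solutions. Indeed `L` maps their span `V` into the solutions of `Q`,
so rank-nullity gives `N ≤ ord Q + dim (ker L)`. Since `ord Q + ord L ≤ N`, this forces `dim (ker L)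
≥ ord L` (`finrank_solutions_of_mul_eq`); the Wronskian argument behind `rank_solutions_le` gives
the reverse bound and `dim (ker Q) ≤ ord Q`.

The field is `k(x, z₁, …, z_ℓ)` with `N = p^(ℓ+1)`. Let `π` be the product of the first `i`
variables and `q = pⁱ`. By induction `∂^(q-1)` sends `π^(p-1)` to a nonzero constant `c`. In
characteristic `p` the map `E = ∂^q` is a derivation. It kills `π^(p-1)`, and for the next variable
`z`, with `z′ = π⁻¹ = π⁻ᵖ π^(p-1)`, it gives the constant `E z = π⁻ᵖ c`. Applying `E^(p-1)` and then
`∂^(q-1)` to `(πz)^(p-1)` thus yields a nonzero constant (`exists_iterate_mul_const`). With all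
variables used, the successive derivatives of the last such power are the required solutions
(`linearIndependent_chain`).

Finally, `p`-th powers are constants, so rescaling a basis by `p`-th powers of its denominators
makes it polynomial (`exists_basis_eq_algebraMap`). -/

theorem derivation_iterate_mul {A : Type*} [CommRing A] (d : Derivation ℤ A A) (n : ℕ) (a b : A) :
    d^[n] (a * b) =
      ∑ ij ∈ Finset.HasAntidiagonal.antidiagonal n, n.choose ij.1 • (d^[ij.1] a * d^[ij.2] b) := by
  induction n with
  | zero => simp
  | succ n ih =>
    rw [Finset.sum_antidiagonal_choose_succ_nsmul (fun i j => d^[i] a * d^[j] b),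
      Function.iterate_succ_apply', ih, map_sum, ← Finset.sum_add_distrib]
    refine Finset.sum_congr rfl fun ij hij => ?_
    rw [map_nsmul, Derivation.leibniz, Function.iterate_succ_apply', Function.iterate_succ_apply',
      ← Finset.HasAntidiagonal.mem_antidiagonal.1 hij, Nat.choose_symm_add, smul_eq_mul, smul_eq_mul, smul_add,
      mul_comm (d^[ij.2] b)]

theorem derivation_iterate_mul_of_eq_zero {A : Type*} [CommRing A] (d : Derivation ℤ A A) (n : ℕ)
    (a : A) {e : A} (he : d e = 0) : d^[n] (e * a) = e * d^[n] a := by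
  induction n with
  | zero => rfl
  | succ n ih => rw [Function.iterate_succ_apply', ih, Derivation.leibniz, he,
      Function.iterate_succ_apply']; simp

theorem derivation_pow_char {A : Type*} [CommRing A] (p : ℕ) [CharP A p]
    (d : Derivation ℤ A A) (a : A) : d (a ^ p) = 0 := by
  rw [Derivation.leibniz_pow]
  simp [nsmul_eq_mul]

/-- In characteristic `p`, the `p`-th iterate of a derivation is a derivation. -/
theorem exists_derivation_iterate_prime {A : Type*} [CommRing A] (p : ℕ) [Fact p.Prime] [CharP A p]
    (d : Derivation ℤ A A) : ∃ E : Derivation ℤ A A, ⇑E = d^[p] := by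
  refine ⟨Derivation.mk' (d.toLinearMap ^ p) fun a b => ?_, ?_⟩
  · have hp := (Fact.out : p.Prime)
    simp only [Module.End.pow_apply]
    change d^[p] (a * b) = a • d^[p] b + b • d^[p] a
    rw [derivation_iterate_mul, Finset.Nat.sum_antidiagonal_eq_sum_range_succ_mk,
      Finset.sum_range_succ, Finset.sum_eq_single 0]
    · simp [mul_comm]
    -- The inner terms of the Leibniz formula vanish because `p` divides their binomial
    -- coefficients.
    · intro i hi hi0
      rw [← Nat.cast_smul_eq_nsmul A, (CharP.cast_eq_zero_iff A p _).2
        (hp.dvd_choose_self hi0 (Finset.mem_range.1 hi)), zero_smul]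
    · exact fun h => absurd (Finset.mem_range.2 hp.pos) h
  · funext a
    exact Module.End.pow_apply _ _ _

theorem exists_derivation_iterate_prime_pow {A : Type*} [CommRing A] (p : ℕ) [Fact p.Prime]
    [CharP A p] (d : Derivation ℤ A A) (i : ℕ) : ∃ E : Derivation ℤ A A, ⇑E = d^[p ^ i] := by
  induction i with
  | zero => exact ⟨d, by simp⟩
  | succ i ih =>
    obtain ⟨E, hE⟩ := ih
    obtain ⟨E', hE'⟩ := exists_derivation_iterate_prime p E
    exact ⟨E', by rw [hE', hE, ← Function.iterate_mul, pow_succ]⟩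

/-- For `E` the elements `u` and `w` are constants, so `z` behaves like a variable with constant
derivative `u`: each application lowers the exponent by one and brings down that exponent times `u`.
-/
theorem derivation_iterate_mul_pow {A : Type*} [CommRing A] (E : Derivation ℤ A A) {z u : A}
    (hz : E z = u) (hu : E u = 0) (m : ℕ) {w : A} (hw : E w = 0) :
    E^[m] (w * z ^ m) = (m.factorial : A) * u ^ m * w := by
  induction m generalizing w with
  | zero => simp
  | succ m ih =>
    have h : E (w * z ^ (m + 1)) = (((m + 1 : ℕ) : A) * u * w) * z ^ m := by
      rw [Derivation.leibniz, Derivation.leibniz_pow, hw, hz]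
      simp
      ring
    rw [Function.iterate_succ_apply, h, ih (by simp [Derivation.leibniz, hu, hw]),
      Nat.factorial_succ]
    push_cast
    ring

/-- If `π^(p-1)` is the top of a chain of length `q = pⁱ` for `d`, and `z′ = 1/π`, then
`(πz)^(p-1)` is the top of a chain of length `pq`. -/
theorem exists_iterate_mul_const {K : Type*} [Field K] (p : ℕ) [Fact p.Prime] [CharP K p]
    (d : Derivation ℤ K K) (i : ℕ) {g z : K} (hg : g ≠ 0) (hz : d z = g⁻¹)
    (h : ∃ c, c ≠ 0 ∧ d c = 0 ∧ d^[p ^ i - 1] (g ^ (p - 1)) = c) :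
    ∃ c, c ≠ 0 ∧ d c = 0 ∧ d^[p ^ (i + 1) - 1] ((g * z) ^ (p - 1)) = c := by
  obtain ⟨c, hc0, hdc, hc⟩ := h
  have hp := (Fact.out : p.Prime)
  have hq : 0 < p ^ i := pow_pos hp.pos i
  obtain ⟨E, hE⟩ := exists_derivation_iterate_prime_pow p d i
  -- The two factorizations of `E = d^q` serve different ends: `hsucc` computes `E z` from `d z`,
  -- while `hsucc'` shows that `E` kills `g^(p-1)`.
  have hsucc : ∀ y, E y = d^[p ^ i - 1] (d y) := fun y => by
    rw [hE, ← Function.iterate_succ_apply, Nat.succ_eq_add_one, Nat.sub_add_cancel hq]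
  have hsucc' : ∀ y, E y = d (d^[p ^ i - 1] y) := fun y => by
    rw [hE, ← Function.iterate_succ_apply' d, Nat.succ_eq_add_one, Nat.sub_add_cancel hq]
  have hconst : ∀ y, d y = 0 → E y = 0 := fun y hy => by
    rw [hsucc, hy, iterate_map_zero]
  have hgp : d (g⁻¹ ^ p) = 0 := derivation_pow_char p d _
  set u := g⁻¹ ^ p * c with hu
  have hdu : d u = 0 := by rw [hu, Derivation.leibniz, hgp, hdc]; simp
  have hEz : E z = u := by
    -- The factor `g⁻ᵖ` is a constant and passes through `d^(q-1)`, leaving the known value at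
    -- `g^(p-1)`.
    have : g⁻¹ = g⁻¹ ^ p * g ^ (p - 1) := by
      obtain ⟨m, hm⟩ : ∃ m, p = m + 1 := ⟨p - 1, (Nat.succ_pred_eq_of_pos hp.pos).symm⟩
      rw [hm, Nat.add_sub_cancel, pow_succ, mul_right_comm, ← mul_pow, inv_mul_cancel₀ hg, one_pow,
        one_mul]
    rw [hsucc, hz, this, derivation_iterate_mul_of_eq_zero d _ _ hgp, hc]
  have hEg : E (g ^ (p - 1)) = 0 := by rw [hsucc', hc, hdc]
  have hfac : ((p - 1).factorial : K) ≠ 0 := by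
    rw [Ne, CharP.cast_eq_zero_iff K p, hp.dvd_factorial]
    have := hp.pos
    omega
  have hd : d (((p - 1).factorial : K) * u ^ (p - 1)) = 0 := by
    simp [Derivation.leibniz, Derivation.leibniz_pow, hdu]
  refine ⟨((p - 1).factorial : K) * u ^ (p - 1) * c, ?_, ?_, ?_⟩
  · exact mul_ne_zero (mul_ne_zero hfac (pow_ne_zero _
      (mul_ne_zero (pow_ne_zero _ (inv_ne_zero hg)) hc0))) hc0
  · rw [Derivation.leibniz, hd, hdc]; simp
  · have hexp : p ^ (i + 1) - 1 = (p ^ i - 1) + p ^ i * (p - 1) := by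
      obtain ⟨m, hm⟩ : ∃ m, p = m + 1 := ⟨p - 1, (Nat.succ_pred_eq_of_pos hp.pos).symm⟩
      rw [pow_succ]
      conv_lhs => rw [show p = (p - 1) + 1 by omega]
      simp only [Nat.sub_add_cancel hp.pos]
      rw [show p ^ i * p = p ^ i * (p - 1) + p ^ i by
        conv_lhs => rw [show p = (p - 1) + 1 by omega, mul_add, mul_one]
        simp only [Nat.sub_add_cancel hp.pos]]
      omega
    rw [hexp, Function.iterate_add_apply, Function.iterate_mul, ← hE, mul_pow,
      derivation_iterate_mul_pow E hEz (hconst u hdu) _ hEg,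
      derivation_iterate_mul_of_eq_zero d _ _ hd, hc]

end Iterate

/-! ### The top of the chain in `k(x, z₁, …, z_ℓ)` -/

instance LogField.charP (p : ℕ) (k : Type*) [Field k] [CharP k p] (ℓ : ℕ) :
    CharP (LogField k ℓ) p :=
  charP_of_injective_algebraMap (algebraMap k (LogField k ℓ)).injective p

theorem LogField.var_ne_zero (k : Type*) [Field k] (ℓ : ℕ) (i : Fin (ℓ + 1)) :
    LogField.var k ℓ i ≠ 0 := by
  rw [LogField.var, Ne, IsFractionRing.to_map_eq_zero_iff]
  exact MvPolynomial.X_ne_zero i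

/-- Induction over the number of variables in the product, starting from the empty product with `p⁰
- 1 = 0` derivatives; the derivative of each variable is the inverse of the product reached so far.
-/
theorem LogField.exists_iterate_deriv (p : ℕ) [Fact p.Prime] (k : Type*) [Field k] [CharP k p]
    (ℓ : ℕ) : ∃ f c : LogField k ℓ, c ≠ 0 ∧ c′ = 0 ∧
      (Differential.deriv : LogField k ℓ → LogField k ℓ)^[p ^ (ℓ + 1) - 1] f = c := by
  have key : ∀ i, i ≤ ℓ + 1 → ∃ c : LogField k ℓ, c ≠ 0 ∧ c′ = 0 ∧
      (Differential.deriv : LogField k ℓ → LogField k ℓ)^[p ^ i - 1]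
        ((∏ j ∈ Finset.univ.filter (fun j : Fin (ℓ + 1) => j.1 < i),
          LogField.var k ℓ j) ^ (p - 1)) = c := by
    intro i
    induction i with
    | zero => exact fun _ => ⟨1, one_ne_zero, by simp, by simp⟩
    | succ i ih =>
      intro hi
      have hset : Finset.univ.filter (fun j : Fin (ℓ + 1) => j.1 < i + 1) =
          insert ⟨i, hi⟩ (Finset.univ.filter (fun j : Fin (ℓ + 1) => j.1 < i)) := by
        ext j
        simp [Fin.ext_iff]
        omega
      have hIio : Finset.Iio (⟨i, hi⟩ : Fin (ℓ + 1)) =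
          Finset.univ.filter (fun j : Fin (ℓ + 1) => j.1 < i) := by
        ext j
        simp [Fin.lt_def]
      rw [hset, Finset.prod_insert (by simp), mul_comm]
      refine exists_iterate_mul_const p Differential.deriv i
        (Finset.prod_ne_zero_iff.2 fun j _ => LogField.var_ne_zero k ℓ j) ?_ (ih (by omega))
      rw [LogField.deriv_var, hIio]
  obtain ⟨c, h⟩ := key (ℓ + 1) le_rfl
  exact ⟨_, c, h⟩

end PCurv

namespace PCurv

/-! ### The order of a product -/

section Order

variable {R : Type*} [CommRing R] [Differential R]

theorem natDegree_leftD_le (f : R[X]) : (leftD f).natDegree ≤ f.natDegree + 1 := by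
  refine Polynomial.natDegree_le_iff_coeff_eq_zero.2 fun m hm => ?_
  rw [leftD_apply, Polynomial.coeff_add, Differential.coeff_mapCoeffs,
    Polynomial.coeff_eq_zero_of_natDegree_lt (by omega)]
  obtain ⟨m, rfl⟩ : ∃ r, m = r + 1 := ⟨m - 1, by omega⟩
  rw [Polynomial.coeff_X_mul, Polynomial.coeff_eq_zero_of_natDegree_lt (by omega)]
  simp

theorem natDegree_leftD_pow_le (f : R[X]) (i : ℕ) :
    ((leftD ^ i) f).natDegree ≤ f.natDegree + i := by
  induction i with
  | zero => simp
  | succ i ih =>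
    rw [pow_succ', Module.End.mul_apply]
    exact (natDegree_leftD_le _).trans (by omega)

theorem coeff_leftD_pow (f : R[X]) (i : ℕ) :
    ((leftD ^ i) f).coeff (f.natDegree + i) = f.leadingCoeff := by
  induction i with
  | zero => simp
  | succ i ih =>
    have h := natDegree_leftD_pow_le f i
    rw [pow_succ', Module.End.mul_apply, leftD_apply, Polynomial.coeff_add,
      Differential.coeff_mapCoeffs, Polynomial.coeff_eq_zero_of_natDegree_lt (by omega),
      ← add_assoc, Polynomial.coeff_X_mul, ih]
    simp

theorem leftMul_apply (P Q : R[X]) :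
    leftMul P Q = P.sum fun i a => Polynomial.C a * (leftD ^ i) Q := by
  simp [leftMul, Polynomial.sum_def, LinearMap.sum_apply, leftC_apply]

/-- Only the top term of `P` reaches this degree; lower terms give operators of smaller order. Over
a domain the coefficient is nonzero, so orders add. -/
theorem coeff_leftMul (P Q : R[X]) :
    (leftMul P Q).coeff (Q.natDegree + P.natDegree) = P.leadingCoeff * Q.leadingCoeff := by
  rw [leftMul_apply, Polynomial.sum_over_range _ (by simp), Polynomial.finsetSum_coeff,
    Finset.sum_range_succ, Finset.sum_eq_zero, zero_add, Polynomial.coeff_C_mul, coeff_leftD_pow]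
  · rfl
  · intro i hi
    have h := natDegree_leftD_pow_le Q i
    have hi := Finset.mem_range.1 hi
    rw [Polynomial.coeff_C_mul,
      Polynomial.coeff_eq_zero_of_natDegree_lt (p := (leftD ^ i) Q) (by omega), mul_zero]

theorem DiffOp.order_add_order_le [IsDomain R] {P Q : DiffOp R} (hP : P.toPoly ≠ 0)
    (hQ : Q.toPoly ≠ 0) : P.order + Q.order ≤ (P * Q).order := by
  rw [add_comm]
  refine Polynomial.le_natDegree_of_ne_zero ?_
  change (leftMul P.toPoly Q.toPoly).coeff (Q.toPoly.natDegree + P.toPoly.natDegree) ≠ 0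
  rw [coeff_leftMul]
  exact mul_ne_zero (Polynomial.leadingCoeff_ne_zero.2 hP) (Polynomial.leadingCoeff_ne_zero.2 hQ)

end Order

/-! ### The action of operators -/

section Action

variable {F : Type*} [Field F] [Differential F] {R : Type*} [CommRing R]

theorem act_eq (φ : R →+* F) (L : DiffOp R) :
    L.act φ = L.toPoly.sum fun i a => LinearMap.mulLeft (constants F) (φ a) * derivLin F ^ i := rfl

theorem act_add (φ : R →+* F) (P Q : R[X]) :
    (DiffOp.ofPoly (P + Q)).act φ = (DiffOp.ofPoly P).act φ + (DiffOp.ofPoly Q).act φ :=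
  Polynomial.sum_add_index P Q _ (fun i => by ext; simp) (fun i a b => by
    ext; simp [add_mul])

theorem act_monomial (φ : R →+* F) (n : ℕ) (a : R) :
    (DiffOp.ofPoly (Polynomial.monomial n a)).act φ =
      LinearMap.mulLeft (constants F) (φ a) * derivLin F ^ n :=
  Polynomial.sum_monomial_index a _ (by ext; simp)

theorem act_map {S : Type*} [CommRing S] (ψ : R →+* S) (φ : S →+* F) (L : DiffOp R) :
    (L.map ψ).act φ = L.act (φ.comp ψ) := by
  change (DiffOp.ofPoly (Polynomial.map ψ L.toPoly)).act φ =
    (DiffOp.ofPoly L.toPoly).act (φ.comp ψ)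
  induction L.toPoly using Polynomial.induction_on' with
  | add P Q hP hQ => rw [Polynomial.map_add, act_add, act_add, hP, hQ]
  | monomial n a => rw [Polynomial.map_monomial, act_monomial, act_monomial]; rfl

variable [Differential R]

/-- By additivity it is enough to treat left multiplication by a coefficient and by `∂`; the latter
is the Leibniz rule and needs `φ` to commute with the derivations. -/
theorem act_mul (φ : R →+* F) (hφ : ∀ a, φ (a′) = (φ a)′) (P Q : DiffOp R) :
    (P * Q).act φ = P.act φ * Q.act φ := by
  have hC : ∀ (a : R) (Q : R[X]), (DiffOp.ofPoly (leftC a Q)).act φ =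
      LinearMap.mulLeft (constants F) (φ a) * (DiffOp.ofPoly Q).act φ := by
    intro a Q
    induction Q using Polynomial.induction_on' with
    | add P Q hP hQ => rw [map_add, act_add, act_add, hP, hQ, mul_add]
    | monomial n b =>
      rw [leftC_apply, Polynomial.C_mul_monomial, act_monomial, act_monomial]
      ext y
      simp
  have hD : ∀ Q : R[X], (DiffOp.ofPoly (leftD Q)).act φ =
      derivLin F * (DiffOp.ofPoly Q).act φ := by
    intro Q
    induction Q using Polynomial.induction_on' with
    | add P Q hP hQ => rw [map_add, act_add, act_add, hP, hQ, mul_add]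
    | monomial n b =>
      rw [leftD_monomial, act_add, act_monomial, act_monomial, act_monomial, pow_succ']
      ext y
      simp only [LinearMap.add_apply, Module.End.mul_apply, LinearMap.mulLeft_apply, hφ]
      change _ = Differential.deriv (φ b * (derivLin F ^ n) y)
      rw [Derivation.leibniz, smul_eq_mul, smul_eq_mul, add_comm, mul_comm ((derivLin F ^ n) y)]
      rfl
  have hDn : ∀ (n : ℕ) (Q : R[X]), (DiffOp.ofPoly ((leftD ^ n) Q)).act φ =
      derivLin F ^ n * (DiffOp.ofPoly Q).act φ := by
    intro n Q
    induction n with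
    | zero => simp
    | succ n ih => rw [pow_succ', Module.End.mul_apply, hD, ih, pow_succ', mul_assoc]
  change (DiffOp.ofPoly (leftMul P.toPoly Q.toPoly)).act φ =
    (DiffOp.ofPoly P.toPoly).act φ * (DiffOp.ofPoly Q.toPoly).act φ
  induction P.toPoly using Polynomial.induction_on' with
  | add P P' hP hP' => rw [leftMul_add, LinearMap.add_apply, act_add, act_add, hP, hP', add_mul]
  | monomial n a => rw [leftMul_monomial, Module.End.mul_apply, hC, hDn, act_monomial, mul_assoc]

theorem act_D_pow (φ : R →+* F) (n : ℕ) : (DiffOp.D ^ n : DiffOp R).act φ = derivLin F ^ n := by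
  rw [act_eq, DiffOp.D_pow_eq, ← Polynomial.monomial_one_right_eq_X_pow]
  refine (act_monomial φ n 1).trans ?_
  ext y
  simp

end Action

/-! ### The dimension of the space of solutions -/

section Dimension

variable {F : Type*} [Field F] [Differential F]

/-- Solutions that are linearly independent over the constants have linearly independent vectors
of derivatives. -/
theorem linearIndependent_iterate_deriv {R : Type*} [CommRing R] (φ : R →+* F) (L : DiffOp R)
    (hL : φ L.toPoly.leadingCoeff ≠ 0) (m : ℕ) (y : Fin m → F)
    (hy : LinearIndependent (constants F) y) (hs : ∀ i, y i ∈ L.solutions φ) :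
    LinearIndependent F
      (fun i (j : Fin L.order) => (Differential.deriv : F → F)^[j] (y i)) := by
  -- Dividing by the leading coefficient expresses the derivative of order `L.order` of any solution
  -- through the lower ones, with the same coefficients for all solutions.
  have hbound : ∃ b : Fin L.order → F, ∀ z ∈ L.solutions φ,
      (Differential.deriv : F → F)^[L.order] z =
        ∑ j, b j * (Differential.deriv : F → F)^[j] z := by
    refine ⟨fun j => -((φ L.toPoly.leadingCoeff)⁻¹ * φ (L.toPoly.coeff j)), fun z hz => ?_⟩
    have hz : L.act φ z = 0 := hz
    rw [DiffOp.act_apply, Polynomial.sum_over_range _ (by simp), Finset.sum_range_succ] at hz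
    change _ + φ L.toPoly.leadingCoeff * (Differential.deriv : F → F)^[L.order] z = 0 at hz
    refine Eq.trans ?_ (Fin.sum_univ_eq_sum_range (fun j : ℕ =>
      -((φ L.toPoly.leadingCoeff)⁻¹ * φ (L.toPoly.coeff j)) *
        (Differential.deriv : F → F)^[j] z) L.order).symm
    refine mul_left_cancel₀ hL ?_
    rw [Finset.mul_sum, eq_neg_of_add_eq_zero_right hz, ← Finset.sum_neg_distrib]
    refine Finset.sum_congr rfl fun j _ => ?_
    field_simp
  obtain ⟨b, hb⟩ := hbound
  induction m with
  | zero => exact linearIndependent_empty_type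
  | succ m ih =>
    rw [linearIndependent_finSucc] at hy ⊢
    have htail := ih _ hy.1 fun i => hs _
    refine ⟨htail, fun hmem => hy.2 ?_⟩
    obtain ⟨c, hc⟩ := (Submodule.mem_span_range_iff_exists_fun F).1 hmem
    have hc' : ∀ j : Fin L.order, (Differential.deriv : F → F)^[j] (y 0) =
        ∑ i : Fin m, c i * (Differential.deriv : F → F)^[j] (y i.succ) := fun j => by
      have := congrFun hc j
      simpa [Fin.tail] using this.symm
    have hlast : (Differential.deriv : F → F)^[L.order] (y 0) =
        ∑ i : Fin m, c i * (Differential.deriv : F → F)^[L.order] (y i.succ) := by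
      rw [hb _ (hs 0)]
      simp_rw [fun i : Fin m => hb _ (hs i.succ), hc', Finset.mul_sum]
      rw [Finset.sum_comm]
      exact Finset.sum_congr rfl fun i _ => Finset.sum_congr rfl fun j _ => by ring
    -- The relation must include `j = L.order`, so that the relation for each `j < L.order` can be
    -- differentiated and compared with the next one.
    have hall : ∀ j, j ≤ L.order → (Differential.deriv : F → F)^[j] (y 0) =
        ∑ i : Fin m, c i * (Differential.deriv : F → F)^[j] (y i.succ) := fun j hj => by
      rcases hj.lt_or_eq with h | rfl
      · exact hc' ⟨j, h⟩
      · exact hlast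
    -- The difference is a relation among the tail vectors with coefficients `(c i)′`, which
    -- therefore vanish. The relation for `j = 0` is then a dependence over the constants.
    have hder : ∀ i, (c i)′ = 0 := by
      refine Fintype.linearIndependent_iff.1 htail (fun i => (c i)′) (funext fun j => ?_)
      have h1 := hall (j + 1) j.2
      rw [Function.iterate_succ_apply', hall j j.2.le, map_sum] at h1
      simp only [Derivation.leibniz, smul_eq_mul, Finset.sum_add_distrib,
        ← Function.iterate_succ_apply' (Differential.deriv : F → F)] at h1
      simpa [Fin.tail, mul_comm] using h1
    refine (Submodule.mem_span_range_iff_exists_fun _).2 ⟨fun i => ⟨c i, hder i⟩, ?_⟩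
    exact (hall 0 (Nat.zero_le _)).symm

theorem rank_solutions_le {R : Type*} [CommRing R] (φ : R →+* F) (L : DiffOp R)
    (hL : φ L.toPoly.leadingCoeff ≠ 0) :
    Module.rank (constants F) (L.solutions φ) ≤ L.order := by
  refine rank_le fun s hs => ?_
  have h := linearIndependent_iterate_deriv φ L hL s.card (fun i => (s.equivFin.symm i).1.1)
    ((hs.comp _ s.equivFin.symm.injective).map' (L.solutions φ).subtype
      (Submodule.ker_subtype _)) fun i => (s.equivFin.symm i).1.2
  simpa using h.fintype_card_le_finrank

theorem derivLin_pow_iterate_eq_zero {f c : F} (hdc : c′ = 0) (N i : ℕ)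
    (hf : (Differential.deriv : F → F)^[N] f = c) :
    (derivLin F ^ (N + 1)) ((Differential.deriv : F → F)^[i] f) = 0 := by
  rw [Module.End.pow_apply]
  change (Differential.deriv : F → F)^[N + 1] ((Differential.deriv : F → F)^[i] f) = 0
  rw [← Function.iterate_add_apply, show N + 1 + i = i + 1 + N by omega,
    Function.iterate_add_apply, hf, Function.iterate_succ_apply, hdc, iterate_map_zero]

/-- A chain of length `N` makes the kernel of `∂ᴺ` at least `N`-dimensional. -/
theorem linearIndependent_chain {f c : F} (hc : c ≠ 0) (hdc : c′ = 0) (N : ℕ)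
    (hf : (Differential.deriv : F → F)^[N] f = c) :
    LinearIndependent (constants F)
      (fun i : Fin (N + 1) => (Differential.deriv : F → F)^[i] f) := by
  induction N generalizing f with
  | zero =>
    refine Fintype.linearIndependent_iff.2 fun g hg => Fin.forall_fin_one.2 ?_
    have h : g 0 • f = 0 := (Fin.sum_univ_one _).symm.trans hg
    exact (smul_eq_zero.1 h).resolve_right fun h0 => hc (hf.symm.trans h0)
  | succ N ih =>
    rw [linearIndependent_finSucc]
    refine ⟨ih hf, fun hmem => hc ?_⟩
    -- All later members of the chain are killed by `∂^(N+1)`, whereas `f` is sent to `c ≠ 0`.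
    have hle : Submodule.span (constants F) (Set.range (Fin.tail
        (fun i : Fin (N + 1 + 1) => (Differential.deriv : F → F)^[i] f))) ≤
        LinearMap.ker (derivLin F ^ (N + 1)) := by
      rw [Submodule.span_le]
      rintro _ ⟨i, rfl⟩
      exact derivLin_pow_iterate_eq_zero (f := f′) hdc N i hf
    have h := hle hmem
    rw [LinearMap.mem_ker, Module.End.pow_apply] at h
    exact hf.symm.trans h

end Dimension

end PCurv

namespace PCurv

/-! ### Solutions of operators with nilpotent `p`-curvature -/

/-- If `Q L = ∂ᴺ` and the kernel of `∂ᴺ` has dimension at least `N`, then `L` has a full space of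
solutions. -/
theorem finrank_solutions_of_mul_eq {R F : Type*} [CommRing R] [IsDomain R] [Differential R]
    [Field F] [Differential F] (φ : R →+* F) (hφ : ∀ a, φ (a′) = (φ a)′)
    (hinj : Function.Injective φ) {Q L : DiffOp R} {N : ℕ} (hQL : Q * L = DiffOp.D ^ N)
    {v : Fin N → F} (hv : LinearIndependent (constants F) v)
    (hvN : ∀ i, (derivLin F ^ N) (v i) = 0) :
    Module.Finite (constants F) (L.solutions φ) ∧
      Module.finrank (constants F) (L.solutions φ) = L.order := by
  have hne : (Q * L).toPoly ≠ 0 := by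
    rw [hQL, DiffOp.D_pow_eq]
    exact pow_ne_zero _ Polynomial.X_ne_zero
  have hQ : Q.toPoly ≠ 0 := fun h => hne (by
    rw [DiffOp.mul_def, h, leftMul_zero, LinearMap.zero_apply])
  have hL : L.toPoly ≠ 0 := fun h => hne (by rw [DiffOp.mul_def, h, map_zero])
  have hlead : ∀ P : DiffOp R, P.toPoly ≠ 0 → φ P.toPoly.leadingCoeff ≠ 0 := fun P hP =>
    (map_ne_zero_iff φ hinj).2 (Polynomial.leadingCoeff_ne_zero.2 hP)
  have hord : Q.order + L.order ≤ N := by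
    refine (DiffOp.order_add_order_le hQ hL).trans ?_
    rw [hQL, DiffOp.order, DiffOp.D_pow_eq, Polynomial.natDegree_X_pow]
  have hrL := rank_solutions_le φ L (hlead L hL)
  have hrQ := rank_solutions_le φ Q (hlead Q hQ)
  have hfL : Module.Finite (constants F) (L.solutions φ) :=
    Module.rank_lt_aleph0_iff.1 (hrL.trans_lt (Cardinal.natCast_lt_aleph0))
  have hfQ : Module.Finite (constants F) (Q.solutions φ) :=
    Module.rank_lt_aleph0_iff.1 (hrQ.trans_lt (Cardinal.natCast_lt_aleph0))
  have hrL' : Module.finrank (constants F) (L.solutions φ) ≤ L.order :=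
    Module.finrank_le_of_rank_le hrL
  have hrQ' : Module.finrank (constants F) (Q.solutions φ) ≤ Q.order :=
    Module.finrank_le_of_rank_le hrQ
  refine ⟨hfL, le_antisymm hrL' ?_⟩
  set V := Submodule.span (constants F) (Set.range v) with hV
  have hfV : Module.Finite (constants F) V := Module.Finite.span_of_finite _ (Set.finite_range v)
  have hdV : Module.finrank (constants F) V = N := by
    rw [hV, finrank_span_eq_card hv, Fintype.card_fin]
  have hVker : ∀ y ∈ V, Q.act φ (L.act φ y) = 0 := by
    intro y hy
    have hle : V ≤ LinearMap.ker (derivLin F ^ N) := by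
      rw [hV, Submodule.span_le]
      rintro _ ⟨i, rfl⟩
      exact hvN i
    have h : (derivLin F ^ N) y = 0 := hle hy
    rwa [← act_D_pow φ, ← hQL, act_mul φ hφ] at h
  -- Since `Q * L` kills `V`, `L` restricts to a map from `V` to the solutions of `Q`, and its
  -- kernel embeds in the solutions of `L`.
  let g : V →ₗ[constants F] Q.solutions φ :=
    ((L.act φ).comp V.subtype).codRestrict _ fun y => hVker y y.2
  have hker : Module.finrank (constants F) (LinearMap.ker g) ≤
      Module.finrank (constants F) (L.solutions φ) := by
    let i : LinearMap.ker g →ₗ[constants F] L.solutions φ :=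
      (V.subtype.comp (LinearMap.ker g).subtype).codRestrict _ fun y =>
        congrArg Subtype.val (LinearMap.mem_ker.1 y.2)
    refine LinearMap.finrank_le_finrank_of_injective (f := i) fun a b hab => ?_
    exact Subtype.ext (Subtype.ext (congrArg (fun z : L.solutions φ => (z : F)) hab))
  have hrange := Submodule.finrank_le (LinearMap.range g)
  have hsum := LinearMap.finrank_range_add_finrank_ker g
  omega

/-- If the `s`-th power of the `p`-curvature is zero, its value on the class of `1` shows that
`∂^(ps)` lies in the left ideal generated by `L`; higher powers of `∂` follow by left
multiplication. -/
theorem DiffOp.exists_mul_eq_D_pow {R : Type*} [CommRing R] [Differential R] (p : ℕ)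
    (L : DiffOp R) (hL : IsNilpotent (L.pCurvature p)) :
    ∃ s : ℕ, ∀ N, p * s ≤ N → ∃ Q : DiffOp R, Q * L = DiffOp.D ^ N := by
  obtain ⟨s, hs⟩ := hL
  refine ⟨s, fun N hN => ?_⟩
  have h : ∀ n (u : DiffOp R), ((L.pCurvature p) ^ n) (Submodule.Quotient.mk u) =
      Submodule.Quotient.mk ((DiffOp.D ^ p) ^ n * u) := by
    intro n u
    induction n with
    | zero => simp
    | succ n ih =>
      rw [pow_succ', Module.End.mul_apply, ih, pow_succ' (DiffOp.D ^ p : DiffOp R), mul_assoc]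
      rfl
  have h1 := h s 1
  rw [hs, LinearMap.zero_apply, mul_one, eq_comm, Submodule.Quotient.mk_eq_zero,
    Submodule.mem_span_singleton] at h1
  obtain ⟨Q, hQ⟩ := h1
  refine ⟨DiffOp.D ^ (N - p * s) * Q, ?_⟩
  rw [mul_assoc, ← smul_eq_mul Q, hQ, ← pow_mul, ← pow_add, Nat.sub_add_cancel hN]

theorem aeval_derivative {k K : Type*} [CommRing k] [CommRing K] [Algebra k K]
    (d : Derivation ℤ K K) {x : K} (hx : d x = 1) (hk : ∀ c, d (algebraMap k K c) = 0) (f : k[X]) :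
    Polynomial.aeval x (Polynomial.derivative f) = d (Polynomial.aeval x f) := by
  induction f using Polynomial.induction_on' with
  | add f g hf hg => simp only [map_add, hf, hg]
  | monomial n a =>
    rw [Polynomial.derivative_monomial, Polynomial.aeval_monomial, Polynomial.aeval_monomial,
      Derivation.leibniz, hk, Derivation.leibniz_pow, hx]
    simp
    ring

/-- In characteristic `p`, a finite-dimensional space over the constants of a field of fractions
has a basis without denominators. -/
theorem exists_basis_eq_algebraMap {A K : Type*} [CommRing A] [IsDomain A] [Field K] [Algebra A K]
    [IsFractionRing A K] [Differential K] (p : ℕ) [Fact p.Prime] [CharP K p]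
    (V : Submodule (constants K) K) [Module.Finite (constants K) V] {n : ℕ}
    (hn : Module.finrank (constants K) V = n) :
    ∃ b : Module.Basis (Fin n) (constants K) V, ∀ i, ∃ q : A, (b i : K) = algebraMap A K q := by
  have hp := (Fact.out : p.Prime)
  let b := Module.finBasisOfFinrankEq _ _ hn
  choose num den hden hb using fun i => IsFractionRing.div_surjective (A := A) (b i : K)
  have hden0 : ∀ i, algebraMap A K (den i) ≠ 0 := fun i => by
    rw [Ne, IsFractionRing.to_map_eq_zero_iff]
    exact nonZeroDivisors.ne_zero (hden i)
  let w : Fin n → constants K := fun i =>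
    ⟨algebraMap A K (den i) ^ p, derivation_pow_char p Differential.deriv _⟩
  have hw : ∀ i, IsUnit (w i) := fun i => isUnit_iff_ne_zero.2 fun h =>
    pow_ne_zero p (hden0 i) (congrArg Subtype.val h)
  -- Multiplying `num / den` by the constant `denᵖ` leaves `den^(p-1) * num`.
  refine ⟨b.isUnitSMul hw, fun i => ⟨den i ^ (p - 1) * num i, ?_⟩⟩
  rw [Module.Basis.isUnitSMul_apply, Submodule.coe_smul, Subfield.smul_def, smul_eq_mul, ← hb]
  change algebraMap A K (den i) ^ p * _ = _
  rw [map_mul, map_pow]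
  conv_lhs => rw [← Nat.sub_add_cancel hp.one_le, pow_succ, mul_assoc, mul_div_cancel₀ _ (hden0 i)]

/-! ### The differential embeddings of `k[x]` and `k(x)` in `k(x, z₁, …, z_ℓ)` -/

section

variable (k : Type*) [Field k] (ℓ : ℕ)

theorem LogField.ofPoly_injective : Function.Injective (LogField.ofPoly k ℓ) := by
  have h : ∀ f : k[X], LogField.ofPoly k ℓ f =
      algebraMap (MvPolynomial (Fin (ℓ + 1)) k) (LogField k ℓ)
        (Polynomial.aeval (MvPolynomial.X 0) f) := fun f => by
    change Polynomial.aeval (LogField.var k ℓ 0) f = _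
    rw [LogField.var, Polynomial.aeval_algebraMap_apply]
  intro f g hfg
  rw [h, h] at hfg
  have := IsFractionRing.injective (MvPolynomial (Fin (ℓ + 1)) k) (LogField k ℓ) hfg
  exact transcendental_iff_injective.1 (MvPolynomial.transcendental_X k (0 : Fin (ℓ + 1))) this

theorem LogField.deriv_algebraMap (c : k) : (algebraMap k (LogField k ℓ) c)′ = 0 := by
  rw [IsScalarTower.algebraMap_apply k (MvPolynomial (Fin (ℓ + 1)) k)]
  refine (fracDeriv_algebraMap _ _).trans ?_
  exact Derivation.map_algebraMap (MvPolynomial.mkDerivation k _) c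

theorem LogField.ofPoly_deriv (f : k[X]) :
    LogField.ofPoly k ℓ (f′) = (LogField.ofPoly k ℓ f)′ := by
  have hx : (LogField.var k ℓ 0)′ = 1 := by
    rw [LogField.deriv_var, Finset.prod_eq_one, inv_one]
    exact fun j hj => absurd (Finset.mem_Iio.1 hj) (Fin.not_lt_zero j)
  exact aeval_derivative Differential.deriv hx (LogField.deriv_algebraMap k ℓ) f

/-- The inclusion of `k(x)` in `k(x, z₁, …, z_ℓ)`. -/
noncomputable def LogField.ofRatFunc : RatFunc k →+* LogField k ℓ :=
  IsFractionRing.lift (LogField.ofPoly_injective k ℓ)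

theorem LogField.ofRatFunc_algebraMap (f : k[X]) :
    LogField.ofRatFunc k ℓ (algebraMap k[X] (RatFunc k) f) = LogField.ofPoly k ℓ f :=
  IsFractionRing.lift_algebraMap _ f

theorem RatFunc.deriv_algebraMap (f : k[X]) :
    (algebraMap k[X] (RatFunc k) f)′ = algebraMap k[X] (RatFunc k) (f′) := by
  refine (fracDeriv_algebraMap _ _).trans ?_
  change Polynomial.mkDerivation k (1 : RatFunc k) f =
    algebraMap k[X] (RatFunc k) (Polynomial.derivative f)
  rw [Polynomial.mkDerivation_apply, Algebra.smul_def, mul_one]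

/-- The quotient rule reduces this to polynomials, where both derivations are determined by `x′ = 1`
and vanish on `k`. -/
theorem LogField.ofRatFunc_deriv (f : RatFunc k) :
    LogField.ofRatFunc k ℓ (f′) = (LogField.ofRatFunc k ℓ f)′ := by
  obtain ⟨a, b, hb, rfl⟩ := IsFractionRing.div_surjective (A := k[X]) f
  have hb0 : LogField.ofPoly k ℓ b ≠ 0 :=
    (map_ne_zero_iff _ (LogField.ofPoly_injective k ℓ)).2 (nonZeroDivisors.ne_zero hb)
  simp only [Derivation.leibniz_div, RatFunc.deriv_algebraMap, map_div₀, map_mul, map_sub, map_pow,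
    smul_eq_mul, LogField.ofRatFunc_algebraMap, LogField.ofPoly_deriv, map_inv₀]

end

theorem order_map {R S : Type*} [CommRing R] [CommRing S] (φ : R →+* S)
    (hφ : Function.Injective φ) (L : DiffOp R) : (L.map φ).order = L.order :=
  Polynomial.natDegree_map_eq_of_injective hφ L.toPoly

end PCurv

open PCurv in
theorem corollary4p6 (p : ℕ) [Fact p.Prime] (k : Type*) [Field k] [CharP k p]
    (L : PCurv.DiffOp (Polynomial k))
    (hL : IsNilpotent
      (PCurv.DiffOp.pCurvature p (L.map (algebraMap (Polynomial k) (RatFunc k))))) :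
    ∃ (ℓ : ℕ) (b : Module.Basis (Fin L.order) (PCurv.constants (PCurv.LogField k ℓ))
        (L.solutions (PCurv.LogField.ofPoly k ℓ))),
      ∀ i, ∃ q : MvPolynomial (Fin (ℓ + 1)) k,
        (b i : PCurv.LogField k ℓ) =
          algebraMap (MvPolynomial (Fin (ℓ + 1)) k) (PCurv.LogField k ℓ) q := by
  have hp := (Fact.out : p.Prime)
  obtain ⟨s, hs⟩ := DiffOp.exists_mul_eq_D_pow p _ hL
  -- A generous choice: only `p * s ≤ p^(ℓ+1)` is needed, and `ℓ < p^ℓ`.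
  set ℓ := p * s with hℓ
  obtain ⟨Q, hQ⟩ := hs (p ^ (ℓ + 1)) ((Nat.lt_pow_self hp.one_lt).le.trans
    (Nat.pow_le_pow_right hp.pos ℓ.le_succ))
  obtain ⟨f, c, hc0, hdc, hf⟩ := LogField.exists_iterate_deriv p k ℓ
  have hpos : p ^ (ℓ + 1) - 1 + 1 = p ^ (ℓ + 1) := Nat.sub_add_cancel (pow_pos hp.pos _)
  -- The factorization of `∂ᴺ` holds over `k(x)`, while the solutions in the theorem are formed over
  -- `k[x]`.
  have hsol : L.solutions (LogField.ofPoly k ℓ) =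
      (L.map (algebraMap k[X] (RatFunc k))).solutions (LogField.ofRatFunc k ℓ) := by
    have hcomp : (LogField.ofRatFunc k ℓ).comp (algebraMap k[X] (RatFunc k)) =
      LogField.ofPoly k ℓ := RingHom.ext (LogField.ofRatFunc_algebraMap k ℓ)
    rw [DiffOp.solutions, DiffOp.solutions, act_map, hcomp]
  obtain ⟨hfin, hrank⟩ := finrank_solutions_of_mul_eq (LogField.ofRatFunc k ℓ)
    (LogField.ofRatFunc_deriv k ℓ) (LogField.ofRatFunc k ℓ).injective (hpos ▸ hQ)
    (linearIndependent_chain hc0 hdc _ hf) fun i =>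
      derivLin_pow_iterate_eq_zero hdc _ i hf
  rw [← hsol] at hfin hrank
  rw [order_map _ (IsFractionRing.injective k[X] (RatFunc k))] at hrank
  exact ⟨ℓ, exists_basis_eq_algebraMap p _ hrank⟩
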